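/- Let $\operatorname{Bess}$ be the Bessel operad: the symmetric operad in graded $\mathbb{Q}$-vector spaces (with Koszul signs), defined on finite sets of labels, generated by a symmetric element $E_{i,j}$ of degree $0$ and an antisymmetric element $\Omega_{i,j}$ of degree $1$ in $\operatorname{Bess}(\{i,j\})$, with the relations $$E_{i,\star}\circ_\star E_{j,k}=E_{k,\star}\circ_\star E_{i,j},\qquad \Omega_{i,\star}\circ_\star E_{j,k}=E_{j,\star}\circ_\star\Omega_{i,k}+E_{k,\star}\circ_\star\Omega_{i,j}.$$ For a finite set $I$, $\operatorname{Bess}(I)$ has a basis indexed by the forests of rooted binary trees with leaves labelled bijectively by $I$ (each forest taken with a chosen orientation); here $E$ acts by disjoint union, $\Omega$ joins two trees at a new inner vertex, and the degree is the number of inner vertices. Let $\Delta:\operatorname{Bess}\to\operatorname{Bess}\otimes\operatorname{Bess}$ be the morphism of operads with $$\Delta(E_{i,j})=E_{i,j}\otimes E_{i,j},\qquad \Delta(\Omega_{i,j})=E_{i,j}\otimes\Omega_{i,j}+\Omega_{i,j}\otimes E_{i,j}.$$ Let $\operatorname{Bess}^*(I)$ be the dual space of $\operatorname{Bess}(I)$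 with the product $(f\times g)(x)=\sum f(x')\,g(x'')$ for $\Delta(x)=\sum x'\otimes x''$ (no Koszul sign; this is the opposite of the graded dual product). For $i\neq j$ in $I$, let $Y_{i,j}\in\operatorname{Bess}^*(I)$ be the element of the dual basis that corresponds to the forest on $I$ with exactly one inner vertex, whose only nontrivial tree has the leaves $i,j$, oriented as $\Omega_{i,j}$. Then, for any three distinct elements $i,j,k$ of a finite set $I$, $$Y_{i,j}\times Y_{j,k}\times Y_{k,i}=0\quad\text{in }\operatorname{Bess}^*(I),$$ for either way of placing the parentheses. -/

import Mathlib

open scoped TensorProduct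

namespace Bessel

noncomputable section

set_option linter.unusedSectionVars false

/-- Binary composites of the two generators `E` and `Ω` of the Bessel operad, with inputs labelled
by `I`.  `E a b` is the operadic composite `(E_{⋆,#} ∘_⋆ a) ∘_# b`, and `Ω a b` is
`(Ω_{⋆,#} ∘_⋆ a) ∘_# b`.  A term without `E` is a rooted binary tree, whose inner vertices are the
nodes `Ω`; `E` is disjoint union. -/
inductive Term (I : Type*) : Type _
  | leaf (i : I) : Term I
  | E (a b : Term I) : Term I
  | Ω (a b : Term I) : Term I

namespace Term

variable {I : Type*}

/-- The multiset of labels of the leaves. -/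
def leaves : Term I → Multiset I
  | leaf i => {i}
  | E a b => a.leaves + b.leaves
  | Ω a b => a.leaves + b.leaves

/-- The degree: `E` has degree `0` and `Ω` has degree `1`. -/
def deg : Term I → ℕ
  | leaf _ => 0
  | E a b => a.deg + b.deg
  | Ω a b => a.deg + b.deg + 1

/-- Terms without `E`: rooted binary trees, with a planar order of the inputs of each inner vertex
that records the orientation. -/
def IsTree : Term I → Prop
  | leaf _ => True
  | E _ _ => False
  | Ω a b => a.IsTree ∧ b.IsTree

/-- Oriented forests: disjoint unions of trees. -/
def IsForest : Term I → Prop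
  | leaf _ => True
  | E a b => a.IsForest ∧ b.IsForest
  | Ω a b => a.IsTree ∧ b.IsTree

/-- The trees of a forest. -/
def trees : Term I → Multiset (Term I)
  | E a b => a.trees + b.trees
  | leaf i => {leaf i}
  | Ω a b => {Ω a b}

end Term

open Term

/-- The Koszul sign `(-1)^n`. -/
def sgn (n : ℕ) : ℚ := (-1) ^ n

section Space

variable {I : Type*}

/-- The relations of the Bessel operad, evaluated at arbitrary terms (in the order of the
variables `a`, `b`, `c`, hence the Koszul signs) and inserted at an arbitrary place:
`E` is symmetric of degree `0`, `Ω` is antisymmetric of degree `1`,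
`E_{i,⋆} ∘_⋆ E_{j,k} = E_{k,⋆} ∘_⋆ E_{i,j}` and
`Ω_{i,⋆} ∘_⋆ E_{j,k} = E_{j,⋆} ∘_⋆ Ω_{i,k} + E_{k,⋆} ∘_⋆ Ω_{i,j}`. -/
inductive Rel : (Term I →₀ ℚ) → Prop
  | symm (a b : Term I) :
      Rel (.single (E a b) 1 - .single (E b a) (sgn (a.deg * b.deg)))
  | antisymm (a b : Term I) :
      Rel (.single (Ω a b) 1 + .single (Ω b a) (sgn (a.deg * b.deg)))
  | assoc (a b c : Term I) :
      Rel (.single (E a (E b c)) 1 - .single (E (E a b) c) 1)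
  | leibniz (a b c : Term I) :
      Rel (.single (Ω a (E b c)) 1 - .single (E (Ω a b) c) 1
        - .single (E b (Ω a c)) (sgn (b.deg * (a.deg + 1))))
  | E_left (r : Term I →₀ ℚ) (t : Term I) : Rel r → Rel (r.mapDomain fun x => E x t)
  | E_right (t : Term I) (r : Term I →₀ ℚ) : Rel r → Rel (r.mapDomain fun x => E t x)
  | Ω_left (r : Term I →₀ ℚ) (t : Term I) : Rel r → Rel (r.mapDomain fun x => Ω x t)
  | Ω_right (t : Term I) (r : Term I →₀ ℚ) : Rel r → Rel (r.mapDomain fun x => Ω t x)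

variable (I) [Fintype I]

/-- Terms in which each element of `I` labels exactly one leaf. -/
abbrev LinTerm : Type _ := {t : Term I // t.leaves = Finset.univ.val}

/-- The relations between such terms. -/
def relations : Submodule ℚ (LinTerm I →₀ ℚ) :=
  Submodule.span ℚ {r | Rel (r.mapDomain Subtype.val)}

/-- The component `Bess(I)` of the Bessel operad, presented by generators and relations. -/
abbrev Bess : Type _ := (LinTerm I →₀ ℚ) ⧸ relations I

variable {I}

/-- The element of `Bess(I)` given by a multilinear term. -/
def mk (t : LinTerm I) : Bess I := (relations I).mkQ (.single t 1)

variable [DecidableEq I]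

/-- The class of a term in `Bess(I)`, extended by `0` to the terms that are not multilinear. -/
def cls (t : Term I) : Bess I := if h : t.leaves = Finset.univ.val then mk ⟨t, h⟩ else 0

end Space

section Coproduct

variable {I : Type*}

/-- The expansion of the coproduct of a term as a list of triples `(c, t', t'')`, which stands for
the sum of the `c • t' ⊗ t''`.  It is the operad morphism with `Δ(E) = E ⊗ E` and
`Δ(Ω) = E ⊗ Ω + Ω ⊗ E`, with the Koszul signs of the composition in the tensor product of two
operads, `(p ⊗ q) ∘ (p' ⊗ q') = (-1)^{|q||p'|} (p ∘ p') ⊗ (q ∘ q')`. -/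
def expand : Term I → List (ℚ × Term I × Term I)
  | leaf i => [(1, leaf i, leaf i)]
  | E a b => (expand a).flatMap fun p => (expand b).map fun q =>
      (p.1 * q.1 * sgn (p.2.2.deg * q.2.1.deg), E p.2.1 q.2.1, E p.2.2 q.2.2)
  | Ω a b =>
      ((expand a).flatMap fun p => (expand b).map fun q =>
        (p.1 * q.1 * sgn (p.2.2.deg * q.2.1.deg), Ω p.2.1 q.2.1, E p.2.2 q.2.2)) ++
      ((expand a).flatMap fun p => (expand b).map fun q =>
        (p.1 * q.1 * sgn (p.2.1.deg + (1 + p.2.2.deg) * q.2.1.deg),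
          E p.2.1 q.2.1, Ω p.2.2 q.2.2))

/-- The value of such an expansion when terms are evaluated by `F` in a vector space. -/
def evalExp {M : Type*} [AddCommGroup M] [Module ℚ M] (F : Term I → M)
    (l : List (ℚ × Term I × Term I)) : M ⊗[ℚ] M :=
  (l.map fun p => p.1 • (F p.2.1 ⊗ₜ[ℚ] F p.2.2)).sum

/-! The expansion is compatible with the relations. -/

theorem sgn_eq {m n : ℕ} (h : (m : ZMod 2) = n) : sgn m = sgn n := by
  have h' : m % 2 = n % 2 := (ZMod.natCast_eq_natCast_iff' m n 2).1 h
  unfold sgn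
  rw [← Nat.div_add_mod m 2, ← Nat.div_add_mod n 2, h']
  simp [pow_add, pow_mul]

theorem sgn_mul (m n : ℕ) : sgn m * sgn n = sgn (m + n) := (pow_add _ _ _).symm

theorem Rel.homogeneous {r : Term I →₀ ℚ} (h : Rel r) :
    ∃ (m : Multiset I) (d : ℕ), ∀ t ∈ r.support, t.leaves = m ∧ t.deg = d := by
  classical
  have key (r : Term I →₀ ℚ) (f : Term I → Term I) (g : Multiset I → Multiset I) (e : ℕ → ℕ)
      (hf : ∀ t, (f t).leaves = g t.leaves ∧ (f t).deg = e t.deg)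
      (ih : ∃ (m : Multiset I) (d : ℕ), ∀ t ∈ r.support, t.leaves = m ∧ t.deg = d) :
      ∃ (m : Multiset I) (d : ℕ), ∀ t ∈ (r.mapDomain f).support, t.leaves = m ∧ t.deg = d := by
    obtain ⟨m, d, H⟩ := ih
    refine ⟨g m, e d, fun t ht => ?_⟩
    obtain ⟨x, hx, rfl⟩ := Finset.mem_image.1 (Finsupp.mapDomain_support ht)
    rw [(hf x).1, (hf x).2, (H x hx).1, (H x hx).2]
    exact ⟨rfl, rfl⟩
  have sup (t s : Term I) (c : ℚ) (h : (Finsupp.single t c) s ≠ 0) : s = t := by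
    by_contra hne
    exact h (Finsupp.single_eq_of_ne hne)
  induction h with
  | symm a b =>
    refine ⟨a.leaves + b.leaves, a.deg + b.deg, fun t ht => ?_⟩
    rcases Finset.mem_union.1 (Finsupp.support_sub ht) with h | h <;>
      obtain rfl := sup _ _ _ (Finsupp.mem_support_iff.1 h) <;> simp [leaves, deg, add_comm]
  | antisymm a b =>
    refine ⟨a.leaves + b.leaves, a.deg + b.deg + 1, fun t ht => ?_⟩
    rcases Finset.mem_union.1 (Finsupp.support_add ht) with h | h <;>
      obtain rfl := sup _ _ _ (Finsupp.mem_support_iff.1 h) <;> simp [leaves, deg, add_comm]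
  | assoc a b c =>
    refine ⟨a.leaves + b.leaves + c.leaves, a.deg + b.deg + c.deg, fun t ht => ?_⟩
    rcases Finset.mem_union.1 (Finsupp.support_sub ht) with h | h <;>
      obtain rfl := sup _ _ _ (Finsupp.mem_support_iff.1 h) <;> simp [leaves, deg, add_assoc]
  | leibniz a b c =>
    refine ⟨a.leaves + b.leaves + c.leaves, a.deg + b.deg + c.deg + 1, fun t ht => ?_⟩
    rcases Finset.mem_union.1 (Finsupp.support_sub ht) with h | h
    · rcases Finset.mem_union.1 (Finsupp.support_sub h) with h | h <;>
        obtain rfl := sup _ _ _ (Finsupp.mem_support_iff.1 h) <;>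
        simp only [leaves, deg, add_assoc, true_and] <;> omega
    · obtain rfl := sup _ _ _ (Finsupp.mem_support_iff.1 h)
      simp only [leaves, deg]
      exact ⟨by abel, by omega⟩
  | E_left r t _ ih => exact key r _ (· + t.leaves) (· + t.deg) (fun _ => ⟨rfl, rfl⟩) ih
  | E_right t r _ ih => exact key r _ (t.leaves + ·) (t.deg + ·) (fun _ => ⟨rfl, rfl⟩) ih
  | Ω_left r t _ ih => exact key r _ (· + t.leaves) (· + t.deg + 1) (fun _ => ⟨rfl, rfl⟩) ih
  | Ω_right t r _ ih => exact key r _ (t.leaves + ·) (t.deg + · + 1) (fun _ => ⟨rfl, rfl⟩) ih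

variable (I) in
/-- The span of the relations between all terms. -/
def allRelations : Submodule ℚ (Term I →₀ ℚ) := Submodule.span ℚ {r | Rel r}

variable (I) in
/-- All terms modulo all relations. -/
abbrev Alg : Type _ := (Term I →₀ ℚ) ⧸ allRelations I

/-- The class of a term in `Alg I`. -/
def cA (t : Term I) : Alg I := (allRelations I).mkQ (.single t 1)

theorem linearCombination_cA (r : Term I →₀ ℚ) :
    Finsupp.linearCombination ℚ (cA (I := I)) r = (allRelations I).mkQ r := by
  have : Finsupp.linearCombination ℚ (cA (I := I)) = (allRelations I).mkQ := by
    ext t; simp [cA]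
  rw [this]

theorem linearCombination_cA_of_rel {r : Term I →₀ ℚ} (h : Rel r) :
    Finsupp.linearCombination ℚ (cA (I := I)) r = 0 := by
  rw [linearCombination_cA, Submodule.mkQ_apply, Submodule.Quotient.mk_eq_zero]
  exact Submodule.subset_span h

/-- A function on terms, extended linearly, descends to `Alg I` if it respects the relations. -/
def descend {M : Type*} [AddCommGroup M] [Module ℚ M] (F : Term I → M)
    (hF : ∀ r, Rel r → Finsupp.linearCombination ℚ F r = 0) : Alg I →ₗ[ℚ] M :=
  (allRelations I).liftQ (Finsupp.linearCombination ℚ F)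
    (Submodule.span_le.2 fun r hr => hF r hr)

@[simp] theorem descend_cA {M : Type*} [AddCommGroup M] [Module ℚ M] (F : Term I → M)
    (hF : ∀ r, Rel r → Finsupp.linearCombination ℚ F r = 0) (t : Term I) :
    descend F hF (cA t) = F t := by
  have := LinearMap.congr_fun ((allRelations I).liftQ_mkQ (Finsupp.linearCombination ℚ F)
    (Submodule.span_le.2 fun r hr => hF r hr)) (.single t 1)
  rw [LinearMap.comp_apply, Finsupp.linearCombination_single, one_smul] at this
  exact this

theorem linearCombination_context (f : Term I → Term I) (r : Term I →₀ ℚ)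
    (h : Rel (r.mapDomain f)) : Finsupp.linearCombination ℚ (fun t => cA (f t)) r = 0 := by
  rw [← linearCombination_cA_of_rel h, Finsupp.linearCombination_mapDomain]; rfl

/-- Multiplication of a term by a sign that depends on its degree. -/
def signA (n : ℕ) : Alg I →ₗ[ℚ] Alg I :=
  descend (fun t => sgn (n * t.deg) • cA t) fun r hr => by
    obtain ⟨m, d, H⟩ := hr.homogeneous
    have : Finsupp.linearCombination ℚ (fun t : Term I => sgn (n * t.deg) • cA t) r =
        sgn (n * d) • Finsupp.linearCombination ℚ (cA (I := I)) r := by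
      simp only [Finsupp.linearCombination_apply, Finsupp.sum, Finset.smul_sum]
      refine Finset.sum_congr rfl fun t ht => ?_
      rw [(H t ht).2, smul_comm]
    rw [this, linearCombination_cA_of_rel hr, smul_zero]

def ElA (t : Term I) : Alg I →ₗ[ℚ] Alg I :=
  descend (fun x => cA (E x t)) fun r hr => linearCombination_context _ r (hr.E_left r t)
def ErA (t : Term I) : Alg I →ₗ[ℚ] Alg I :=
  descend (fun x => cA (E t x)) fun r hr => linearCombination_context _ r (hr.E_right t r)
def ΩlA (t : Term I) : Alg I →ₗ[ℚ] Alg I :=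
  descend (fun x => cA (Ω x t)) fun r hr => linearCombination_context _ r (hr.Ω_left r t)
def ΩrA (t : Term I) : Alg I →ₗ[ℚ] Alg I :=
  descend (fun x => cA (Ω t x)) fun r hr => linearCombination_context _ r (hr.Ω_right t r)

theorem cA_symm (a b : Term I) : cA (E b a) = sgn (a.deg * b.deg) • cA (E a b) := by
  have := linearCombination_cA_of_rel (Rel.symm b a)
  simp only [map_sub, Finsupp.linearCombination_single, one_smul, sub_eq_zero] at this
  rw [this, mul_comm]

theorem cA_antisymm (a b : Term I) : cA (Ω b a) = -(sgn (a.deg * b.deg) • cA (Ω a b)) := by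
  have := linearCombination_cA_of_rel (Rel.antisymm b a)
  simp only [map_add, Finsupp.linearCombination_single, one_smul] at this
  rw [eq_neg_of_add_eq_zero_left this, mul_comm]

theorem cA_assoc (a b c : Term I) : cA (E a (E b c)) = cA (E (E a b) c) := by
  have := linearCombination_cA_of_rel (Rel.assoc a b c)
  simpa only [map_sub, Finsupp.linearCombination_single, one_smul, sub_eq_zero] using this

theorem cA_leibniz (a b c : Term I) :
    cA (Ω a (E b c)) = cA (E (Ω a b) c) + sgn (b.deg * (a.deg + 1)) • cA (E b (Ω a c)) := by
  have := linearCombination_cA_of_rel (Rel.leibniz a b c)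
  simp only [map_sub, Finsupp.linearCombination_single, one_smul] at this
  rw [sub_sub, sub_eq_zero] at this
  exact this

theorem cA_left_comm (a b c : Term I) :
    cA (E b (E a c)) = sgn (a.deg * b.deg) • cA (E a (E b c)) := by
  have h := congrArg (ElA c) (cA_symm a b)
  simp only [map_smul, ElA, descend_cA] at h
  rw [cA_assoc, h, cA_assoc]

theorem deg_expand (t : Term I) : ∀ p ∈ expand t, p.2.1.deg + p.2.2.deg = t.deg := by
  induction t with
  | leaf i => simp [expand, deg]
  | E a b iha ihb =>
    intro p hp
    simp only [expand, List.mem_flatMap, List.mem_map] at hp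
    obtain ⟨x, hx, y, hy, rfl⟩ := hp
    have := iha x hx
    have := ihb y hy
    simp only [deg]; omega
  | Ω a b iha ihb =>
    intro p hp
    simp only [expand, List.mem_append, List.mem_flatMap, List.mem_map] at hp
    rcases hp with ⟨x, hx, y, hy, rfl⟩ | ⟨x, hx, y, hy, rfl⟩ <;>
    · have := iha x hx
      have := ihb y hy
      simp only [deg]; omega

section ListSum

variable {α β γ M : Type*} [AddCommGroup M]

/-- The sum of `f` over a list. -/
def lsum (l : List α) (f : α → M) : M := (l.map f).sum

theorem lsum_flatMap (l : List α) (m : List β) (g : α → β → γ) (f : γ → M) :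
    lsum (l.flatMap fun p => m.map (g p)) f = lsum l fun p => lsum m fun q => f (g p q) := by
  induction l with
  | nil => rfl
  | cons x l ih =>
    simp only [lsum] at ih ⊢
    rw [List.flatMap_cons, List.map_append, List.sum_append, ih, List.map_map]; rfl

theorem lsum_append (l m : List α) (f : α → M) : lsum (l ++ m) f = lsum l f + lsum m f := by
  simp [lsum]

theorem lsum_add (l : List α) (f g : α → M) :
    lsum l (fun x => f x + g x) = lsum l f + lsum l g := by
  induction l with
  | nil => simp [lsum]
  | cons x l ih => simp only [lsum, List.map_cons, List.sum_cons] at ih ⊢; rw [ih]; abel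

theorem lsum_comm (l : List α) (m : List β) (f : α → β → M) :
    (lsum l fun x => lsum m fun y => f x y) = lsum m fun y => lsum l fun x => f x y := by
  induction l with
  | nil => induction m <;> simp_all [lsum]
  | cons x l ih =>
    have h (y : β) : lsum (x :: l) (fun x => f x y) = f x y + lsum l (fun x => f x y) := by
      simp [lsum]
    simp only [h, lsum_add, ← ih]
    simp [lsum]

theorem lsum_congr {l : List α} {f g : α → M} (h : ∀ x ∈ l, f x = g x) : lsum l f = lsum l g := by
  unfold lsum
  rw [List.map_congr_left h]

theorem smul_lsum [Module ℚ M] (c : ℚ) (l : List α) (f : α → M) :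
    c • lsum l f = lsum l fun x => c • f x := by
  induction l with
  | nil => simp [lsum]
  | cons x l ih => simp only [lsum, List.map_cons, List.sum_cons, smul_add] at ih ⊢; rw [ih]

theorem lsum_apply {N P : Type*} [AddCommGroup N] [Module ℚ N] [AddCommGroup P] [Module ℚ P]
    (l : List α) (f : α → N →ₗ[ℚ] P) (x : N) : lsum l f x = lsum l fun a => f a x := by
  induction l with
  | nil => simp [lsum]
  | cons y l ih =>
    simp only [lsum, List.map_cons, List.sum_cons, LinearMap.add_apply] at ih ⊢; rw [ih]

theorem map_lsum {N F : Type*} [AddCommGroup N] [FunLike F M N] [AddMonoidHomClass F M N] (φ : F)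
    (l : List α) (f : α → M) : φ (lsum l f) = lsum l fun x => φ (f x) := by
  induction l with
  | nil => simp [lsum]
  | cons x l ih => simp only [lsum, List.map_cons, List.sum_cons, map_add] at ih ⊢; rw [ih]

end ListSum

/-- The coproduct of a term with values in `Alg I ⊗ Alg I`. -/
def coA (t : Term I) : Alg I ⊗[ℚ] Alg I := evalExp cA (expand t)

/-- The summands of the coproduct of `E a b`. -/
def sE (p q : ℚ × Term I × Term I) : ℚ × Term I × Term I :=
  (p.1 * q.1 * sgn (p.2.2.deg * q.2.1.deg), E p.2.1 q.2.1, E p.2.2 q.2.2)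
def sΩ₁ (p q : ℚ × Term I × Term I) : ℚ × Term I × Term I :=
  (p.1 * q.1 * sgn (p.2.2.deg * q.2.1.deg), Ω p.2.1 q.2.1, E p.2.2 q.2.2)
def sΩ₂ (p q : ℚ × Term I × Term I) : ℚ × Term I × Term I :=
  (p.1 * q.1 * sgn (p.2.1.deg + (1 + p.2.2.deg) * q.2.1.deg), E p.2.1 q.2.1, Ω p.2.2 q.2.2)

theorem lsum_expand_E {M : Type*} [AddCommGroup M] (a b : Term I)
    (f : ℚ × Term I × Term I → M) :
    lsum (expand (E a b)) f = lsum (expand a) fun p => lsum (expand b) fun q => f (sE p q) :=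
  lsum_flatMap _ _ _ _

theorem lsum_expand_Ω {M : Type*} [AddCommGroup M] (a b : Term I)
    (f : ℚ × Term I × Term I → M) :
    lsum (expand (Ω a b)) f =
      lsum (expand a) fun p => lsum (expand b) fun q => f (sΩ₁ p q) + f (sΩ₂ p q) := by
  rw [expand, lsum_append, lsum_flatMap, lsum_flatMap, ← lsum_add]
  refine lsum_congr fun p _ => ?_
  rw [← lsum_add]; rfl

/-- The value of a summand. -/
def vA (p : ℚ × Term I × Term I) : Alg I ⊗[ℚ] Alg I := p.1 • (cA p.2.1 ⊗ₜ[ℚ] cA p.2.2)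

theorem coA_eq (t : Term I) : coA t = lsum (expand t) vA := rfl

theorem coA_symm (a b : Term I) : coA (E a b) = sgn (a.deg * b.deg) • coA (E b a) := by
  rw [coA_eq, coA_eq, lsum_expand_E, lsum_expand_E, lsum_comm (expand b), smul_lsum]
  refine lsum_congr fun p hp => ?_
  rw [smul_lsum]
  refine lsum_congr fun q hq => ?_
  rw [← deg_expand a p hp, ← deg_expand b q hq]
  obtain ⟨c, a', a''⟩ := p
  obtain ⟨d, b', b''⟩ := q
  simp only [vA, sE]
  rw [cA_symm a' b', cA_symm a'' b'']
  simp only [TensorProduct.tmul_smul, ← TensorProduct.smul_tmul', smul_smul]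
  congr 1
  have : sgn (a''.deg * b'.deg) = sgn ((a'.deg + a''.deg) * (b'.deg + b''.deg) +
      b''.deg * a'.deg + a''.deg * b''.deg + a'.deg * b'.deg) := by
    apply sgn_eq
    push_cast
    generalize (a'.deg : ZMod 2) = x1, (a''.deg : ZMod 2) = x2, (b'.deg : ZMod 2) = y1,
      (b''.deg : ZMod 2) = y2
    revert x1 x2 y1 y2; decide
  simp only [← sgn_mul] at this
  rw [this]; ring

theorem coA_antisymm (a b : Term I) : coA (Ω a b) = (-sgn (a.deg * b.deg)) • coA (Ω b a) := by
  rw [coA_eq, coA_eq, lsum_expand_Ω, lsum_expand_Ω, lsum_comm (expand b),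
    smul_lsum]
  refine lsum_congr fun p hp => ?_
  rw [smul_lsum]
  refine lsum_congr fun q hq => ?_
  rw [← deg_expand a p hp, ← deg_expand b q hq]
  obtain ⟨c, a', a''⟩ := p
  obtain ⟨d, b', b''⟩ := q
  simp only [vA, sΩ₁, sΩ₂]
  rw [cA_symm a' b', cA_symm a'' b'', cA_antisymm a' b', cA_antisymm a'' b'']
  simp only [TensorProduct.tmul_smul, ← TensorProduct.smul_tmul', smul_smul, smul_add,
    ← neg_smul]
  have h1 : sgn (a''.deg * b'.deg) = sgn ((a'.deg + a''.deg) * (b'.deg + b''.deg) +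
      b''.deg * a'.deg + a''.deg * b''.deg + a'.deg * b'.deg) := by
    apply sgn_eq
    push_cast
    generalize (a'.deg : ZMod 2) = x1, (a''.deg : ZMod 2) = x2, (b'.deg : ZMod 2) = y1,
      (b''.deg : ZMod 2) = y2
    revert x1 x2 y1 y2; decide
  have h2 : sgn (a'.deg + (1 + a''.deg) * b'.deg) =
      sgn ((a'.deg + a''.deg) * (b'.deg + b''.deg) +
      (b'.deg + (1 + b''.deg) * a'.deg) + a''.deg * b''.deg + a'.deg * b'.deg) := by
    apply sgn_eq
    push_cast
    generalize (a'.deg : ZMod 2) = x1, (a''.deg : ZMod 2) = x2, (b'.deg : ZMod 2) = y1,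
      (b''.deg : ZMod 2) = y2
    revert x1 x2 y1 y2; decide
  rw [h1, h2]
  simp only [← sgn_mul]
  match_scalars <;> ring

theorem coA_assoc (a b c : Term I) : coA (E a (E b c)) = coA (E (E a b) c) := by
  rw [coA_eq, coA_eq, lsum_expand_E, lsum_expand_E, lsum_expand_E]
  refine lsum_congr fun p hp => ?_
  rw [lsum_expand_E]
  refine lsum_congr fun q hq => lsum_congr fun r hr => ?_
  simp only [vA, sE, deg]
  rw [cA_assoc, cA_assoc]
  congr 1
  have h : sgn (q.2.2.deg * r.2.1.deg + p.2.2.deg * (q.2.1.deg + r.2.1.deg)) =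
      sgn (p.2.2.deg * q.2.1.deg + (p.2.2.deg + q.2.2.deg) * r.2.1.deg) := by
    congr 1; ring
  simp only [← sgn_mul] at h
  linear_combination p.1 * q.1 * r.1 * h

theorem coA_leibniz (a b c : Term I) : coA (Ω a (E b c)) =
    coA (E (Ω a b) c) + sgn (b.deg * (a.deg + 1)) • coA (E b (Ω a c)) := by
  simp only [coA_eq, lsum_expand_E, lsum_expand_Ω]
  rw [lsum_comm (expand b), smul_lsum, ← lsum_add]
  refine lsum_congr fun p hp => ?_
  rw [smul_lsum, ← lsum_add]
  refine lsum_congr fun q hq => ?_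
  rw [smul_lsum, ← lsum_add, ← lsum_add]
  refine lsum_congr fun r hr => ?_
  rw [← deg_expand a p hp, ← deg_expand b q hq]
  obtain ⟨c, a', a''⟩ := p
  obtain ⟨d, b', b''⟩ := q
  obtain ⟨e, c', c''⟩ := r
  simp only [vA, sE, sΩ₁, sΩ₂, deg]
  rw [cA_leibniz a' b' c', cA_leibniz a'' b'' c'', cA_left_comm a' b' c', cA_left_comm a'' b'' c'',
    cA_assoc a' b' c', cA_assoc a'' b'' c'']
  simp only [TensorProduct.tmul_add, TensorProduct.add_tmul, TensorProduct.tmul_smul,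
    ← TensorProduct.smul_tmul', smul_smul, smul_add]
  match_scalars
  · have h : sgn (b''.deg * c'.deg) * sgn (a''.deg * (b'.deg + c'.deg)) = sgn (a''.deg * b'.deg) *
        sgn ((a''.deg + b''.deg) * c'.deg) := by
      simp only [sgn_mul]
      apply sgn_eq
      push_cast
      generalize (a'.deg : ZMod 2) = x1, (a''.deg : ZMod 2) = x2, (b'.deg : ZMod 2) = y1,
        (b''.deg : ZMod 2) = y2, (c'.deg : ZMod 2) = z1
      revert x1 x2 y1 y2 z1; decide
    linear_combination c * d * e * h
  · have h : sgn (b''.deg * c'.deg) * sgn (a''.deg * (b'.deg + c'.deg)) *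
        sgn (b'.deg * (a'.deg + 1)) = sgn ((b'.deg + b''.deg) * (a'.deg + a''.deg + 1)) *
        sgn (a''.deg * c'.deg) * sgn (b''.deg * (a'.deg + c'.deg + 1)) * sgn (a''.deg * b''.deg) := by
      simp only [sgn_mul]
      apply sgn_eq
      push_cast
      generalize (a'.deg : ZMod 2) = x1, (a''.deg : ZMod 2) = x2, (b'.deg : ZMod 2) = y1,
        (b''.deg : ZMod 2) = y2, (c'.deg : ZMod 2) = z1
      revert x1 x2 y1 y2 z1; decide
    linear_combination c * d * e * h
  · have h : sgn (b''.deg * c'.deg) * sgn (a'.deg + (1 + a''.deg) * (b'.deg + c'.deg)) = 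
        sgn (a'.deg + (1 + a''.deg) * b'.deg) * sgn ((a''.deg + b''.deg + 1) * c'.deg) := by
      simp only [sgn_mul]
      apply sgn_eq
      push_cast
      generalize (a'.deg : ZMod 2) = x1, (a''.deg : ZMod 2) = x2, (b'.deg : ZMod 2) = y1,
        (b''.deg : ZMod 2) = y2, (c'.deg : ZMod 2) = z1
      revert x1 x2 y1 y2 z1; decide
    linear_combination c * d * e * h
  · have h : sgn (b''.deg * c'.deg) * sgn (a'.deg + (1 + a''.deg) * (b'.deg + c'.deg)) *
        sgn (b''.deg * (a''.deg + 1)) = sgn ((b'.deg + b''.deg) * (a'.deg + a''.deg + 1)) *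
        sgn (a'.deg + (1 + a''.deg) * c'.deg) * sgn (b''.deg * (a'.deg + c'.deg)) *
        sgn (a'.deg * b'.deg) := by
      simp only [sgn_mul]
      apply sgn_eq
      push_cast
      generalize (a'.deg : ZMod 2) = x1, (a''.deg : ZMod 2) = x2, (b'.deg : ZMod 2) = y1,
        (b''.deg : ZMod 2) = y2, (c'.deg : ZMod 2) = z1
      revert x1 x2 y1 y2 z1; decide
    linear_combination c * d * e * h

theorem coA_context (f : Term I → Term I) (Φ : Alg I ⊗[ℚ] Alg I →ₗ[ℚ] Alg I ⊗[ℚ] Alg I)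
    (h : ∀ x, coA (f x) = Φ (coA x)) (r : Term I →₀ ℚ)
    (hr : Finsupp.linearCombination ℚ (coA (I := I)) r = 0) :
    Finsupp.linearCombination ℚ (coA (I := I)) (r.mapDomain f) = 0 := by
  rw [Finsupp.linearCombination_mapDomain]
  have : (coA ∘ f : Term I → _) = Φ ∘ coA := funext h
  rw [this, ← Finsupp.apply_linearCombination, hr, map_zero]

theorem coA_rel {r : Term I →₀ ℚ} (h : Rel r) :
    Finsupp.linearCombination ℚ (coA (I := I)) r = 0 := by
  induction h with
  | symm a b => simp [coA_symm a b]
  | antisymm a b => simp [coA_antisymm a b, ← add_smul]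
  | assoc a b c => simp [coA_assoc a b c]
  | leibniz a b c => simp [coA_leibniz a b c]
  | E_left r t _ ih =>
    refine coA_context _ (lsum (expand t) fun q => q.1 • TensorProduct.map (ElA q.2.1)
      (ElA q.2.2 ∘ₗ signA q.2.1.deg)) (fun x => ?_) r ih
    rw [coA_eq, lsum_expand_E, lsum_comm, lsum_apply]
    refine lsum_congr fun q _ => ?_
    rw [LinearMap.smul_apply, coA_eq, map_lsum, smul_lsum]
    refine lsum_congr fun p _ => ?_
    simp only [vA, sE, ElA, signA, map_smul, TensorProduct.map_tmul, LinearMap.comp_apply,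
      descend_cA, TensorProduct.tmul_smul, smul_smul]
    congr 1
    rw [mul_comm p.2.2.deg]; ring
  | E_right t r _ ih =>
    refine coA_context _ (lsum (expand t) fun p => p.1 • TensorProduct.map
      (ErA p.2.1 ∘ₗ signA p.2.2.deg) (ErA p.2.2)) (fun x => ?_) r ih
    rw [coA_eq, lsum_expand_E, lsum_apply]
    refine lsum_congr fun p _ => ?_
    rw [LinearMap.smul_apply, coA_eq, map_lsum, smul_lsum]
    refine lsum_congr fun q _ => ?_
    simp only [vA, sE, ErA, signA, map_smul, TensorProduct.map_tmul, LinearMap.comp_apply,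
      descend_cA, ← TensorProduct.smul_tmul', smul_smul]
    congr 1
    ring
  | Ω_left r t _ ih =>
    refine coA_context _ (lsum (expand t) fun q => q.1 • (TensorProduct.map (ΩlA q.2.1)
      (ElA q.2.2 ∘ₗ signA q.2.1.deg) + sgn q.2.1.deg • TensorProduct.map (ElA q.2.1 ∘ₗ signA 1)
      (ΩlA q.2.2 ∘ₗ signA q.2.1.deg))) (fun x => ?_) r ih
    rw [coA_eq, lsum_expand_Ω, lsum_comm, lsum_apply]
    refine lsum_congr fun q _ => ?_
    rw [LinearMap.smul_apply, coA_eq, map_lsum, smul_lsum]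
    refine lsum_congr fun p _ => ?_
    simp only [vA, sΩ₁, sΩ₂, ElA, ΩlA, signA, map_smul, TensorProduct.map_tmul,
      LinearMap.comp_apply, LinearMap.add_apply, LinearMap.smul_apply,
      descend_cA, TensorProduct.tmul_smul, ← TensorProduct.smul_tmul', smul_smul, smul_add]
    congr 2
    · rw [mul_comm p.2.2.deg]; ring
    · rw [add_mul, ← sgn_mul, ← sgn_mul, mul_comm p.2.2.deg]; ring
  | Ω_right t r _ ih =>
    refine coA_context _ (lsum (expand t) fun p => p.1 • (TensorProduct.map
      (ΩrA p.2.1 ∘ₗ signA p.2.2.deg) (ErA p.2.2) + sgn p.2.1.deg • TensorProduct.map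
      (ErA p.2.1 ∘ₗ signA (1 + p.2.2.deg)) (ΩrA p.2.2))) (fun x => ?_) r ih
    rw [coA_eq, lsum_expand_Ω, lsum_apply]
    refine lsum_congr fun p _ => ?_
    rw [LinearMap.smul_apply, coA_eq, map_lsum, smul_lsum]
    refine lsum_congr fun q _ => ?_
    simp only [vA, sΩ₁, sΩ₂, ErA, ΩrA, signA, map_smul, TensorProduct.map_tmul,
      LinearMap.comp_apply, LinearMap.add_apply, LinearMap.smul_apply,
      descend_cA, TensorProduct.tmul_smul, ← TensorProduct.smul_tmul', smul_smul, smul_add]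
    congr 2
    · ring
    · rw [← sgn_mul, add_mul, one_mul]; ring_nf

section Descent

variable [Fintype I]

theorem linearCombination_mk (s : LinTerm I →₀ ℚ) :
    Finsupp.linearCombination ℚ (mk (I := I)) s = (relations I).mkQ s := by
  have : Finsupp.linearCombination ℚ (mk (I := I)) = (relations I).mkQ := by
    ext t; simp [mk]
  rw [this]

theorem span_mk : Submodule.span ℚ (Set.range (mk (I := I))) = ⊤ := by
  rw [← Finsupp.range_linearCombination, LinearMap.range_eq_top]
  intro x
  obtain ⟨s, rfl⟩ := (relations I).mkQ_surjective x
  exact ⟨s, linearCombination_mk s⟩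

/-- A function on multilinear terms, extended linearly, descends to `Bess(I)` if it respects the
relations. -/
def Bess.lift {M : Type*} [AddCommGroup M] [Module ℚ M] (F : LinTerm I → M)
    (hF : ∀ r : LinTerm I →₀ ℚ, Rel (r.mapDomain Subtype.val) →
      Finsupp.linearCombination ℚ F r = 0) : Bess I →ₗ[ℚ] M :=
  (relations I).liftQ (Finsupp.linearCombination ℚ F) (Submodule.span_le.2 fun r hr => hF r hr)

@[simp] theorem Bess.lift_mk {M : Type*} [AddCommGroup M] [Module ℚ M] (F : LinTerm I → M)
    (hF : ∀ r : LinTerm I →₀ ℚ, Rel (r.mapDomain Subtype.val) →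
      Finsupp.linearCombination ℚ F r = 0) (t : LinTerm I) : Bess.lift F hF (mk t) = F t := by
  have := LinearMap.congr_fun ((relations I).liftQ_mkQ (Finsupp.linearCombination ℚ F)
    (Submodule.span_le.2 fun r hr => hF r hr)) (.single t 1)
  rw [LinearMap.comp_apply, Finsupp.linearCombination_single, one_smul] at this
  exact this

variable [DecidableEq I]

theorem cls_rel {r : Term I →₀ ℚ} (h : Rel r) :
    Finsupp.linearCombination ℚ (cls (I := I)) r = 0 := by
  obtain ⟨m, d, H⟩ := h.homogeneous
  by_cases hm : m = Finset.univ.val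
  · have hs : (r.support : Set (Term I)) ⊆ Set.range (Subtype.val : LinTerm I → Term I) :=
      fun t ht => ⟨⟨t, (H t ht).1.trans hm⟩, rfl⟩
    obtain ⟨s, rfl⟩ : ∃ s : LinTerm I →₀ ℚ, s.mapDomain Subtype.val = r :=
      ⟨_, Finsupp.mapDomain_comapDomain _ Subtype.val_injective r hs⟩
    rw [Finsupp.linearCombination_mapDomain]
    have : (cls ∘ Subtype.val : LinTerm I → Bess I) = mk := by
      funext t; simp only [Function.comp, cls, dif_pos t.2]
    rw [this, linearCombination_mk]
    exact (Submodule.Quotient.mk_eq_zero _).2 (Submodule.subset_span h)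
  · rw [Finsupp.linearCombination_apply]
    refine Finset.sum_eq_zero fun t ht => ?_
    have : cls t = (0 : Bess I) := dif_neg fun h => hm ((H t ht).1.symm.trans h)
    simp only [this, smul_zero]

variable (I) in
/-- The coproduct of `Bess(I)`. -/
def coproduct : Bess I →ₗ[ℚ] Bess I ⊗[ℚ] Bess I :=
  Bess.lift (fun t => evalExp cls (expand t.1)) fun r hr => by
    let P : Alg I →ₗ[ℚ] Bess I := descend cls fun r hr => cls_rel hr
    have h : (fun t : LinTerm I => evalExp cls (expand t.1)) =
        TensorProduct.map P P ∘ coA ∘ Subtype.val := by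
      funext t
      change lsum _ _ = TensorProduct.map P P (lsum _ _)
      rw [map_lsum]
      refine lsum_congr fun p _ => ?_
      simp [P]
    rw [h, ← Finsupp.apply_linearCombination, ← Finsupp.linearCombination_mapDomain, coA_rel hr,
      map_zero]

theorem coproduct_mk (t : LinTerm I) : coproduct I (mk t) = evalExp cls (expand t.1) :=
  Bess.lift_mk _ _ t

end Descent

end Coproduct

section Dual

variable (I : Type*) [Fintype I]

/-- The dual space `Bess*(I)`. -/
abbrev BessDual : Type _ := Module.Dual ℚ (Bess I)

variable {I} [DecidableEq I]

/-- The product of `Bess*(I)`: if `Δ x = ∑ x' ⊗ x''` then `(f * g) x = ∑ f x' * g x''`, without a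
Koszul sign, which is the opposite of the graded dual product. -/
instance : Mul (BessDual I) :=
  ⟨fun f g => LinearMap.mul' ℚ ℚ ∘ₗ TensorProduct.map f g ∘ₗ coproduct I⟩

end Dual

section Y

variable {I : Type*}

/-- `1` for terms of degree `0`, and `0` for the others. -/
def eps (t : Term I) : ℚ := if t.deg = 0 then 1 else 0

theorem eps_E (a b : Term I) : eps (E a b) = eps a * eps b := by
  simp only [eps, deg, Nat.add_eq_zero_iff]
  split_ifs <;> simp_all

theorem eps_Ω (a b : Term I) : eps (Ω a b) = 0 := by simp [eps, deg]

theorem eps_mul_sgn (a : Term I) (n : ℕ) : eps a * sgn (a.deg * n) = eps a := by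
  by_cases h : a.deg = 0 <;> simp [eps, h, sgn]

theorem linearCombination_of_eq {F G H : Term I → ℚ} {r : Term I →₀ ℚ} (α β : ℚ)
    (h : ∀ x ∈ r.support, F x = α * G x + β * H x) (hG : Finsupp.linearCombination ℚ G r = 0)
    (hH : Finsupp.linearCombination ℚ H r = 0) : Finsupp.linearCombination ℚ F r = 0 := by
  have : Finsupp.linearCombination ℚ F r =
      α * Finsupp.linearCombination ℚ G r + β * Finsupp.linearCombination ℚ H r := by
    simp only [Finsupp.linearCombination_apply, Finsupp.sum, Finset.mul_sum,
      ← Finset.sum_add_distrib, smul_eq_mul]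
    refine Finset.sum_congr rfl fun x hx => ?_
    rw [h x hx]; ring
  rw [this, hG, hH]; simp

theorem eps_rel {r : Term I →₀ ℚ} (h : Rel r) : Finsupp.linearCombination ℚ (eps (I := I)) r = 0 := by
  induction h with
  | symm a b =>
    simp only [map_sub, Finsupp.linearCombination_single, smul_eq_mul, eps_E]
    linear_combination -eps b * eps_mul_sgn a b.deg
  | antisymm a b => simp [eps_Ω]
  | assoc a b c => simp [eps_E, mul_assoc]
  | leibniz a b c => simp [eps_E, eps_Ω]
  | E_left r t _ ih =>
    rw [Finsupp.linearCombination_mapDomain]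
    exact linearCombination_of_eq (eps t) 0 (fun x _ => by simp [eps_E, mul_comm]) ih ih
  | E_right t r _ ih =>
    rw [Finsupp.linearCombination_mapDomain]
    exact linearCombination_of_eq (eps t) 0 (fun x _ => by simp [eps_E]) ih ih
  | Ω_left r t _ ih =>
    rw [Finsupp.linearCombination_mapDomain]
    exact linearCombination_of_eq 0 0 (fun x _ => by simp [eps_Ω]) ih ih
  | Ω_right t r _ ih =>
    rw [Finsupp.linearCombination_mapDomain]
    exact linearCombination_of_eq 0 0 (fun x _ => by simp [eps_Ω]) ih ih

variable [DecidableEq I]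

/-- The number of leaves labelled `i`. -/
def cnt (i : I) (t : Term I) : ℚ := t.leaves.count i

theorem cnt_E (i : I) (a b : Term I) : cnt i (E a b) = cnt i a + cnt i b := by simp [cnt, leaves]

/-- The coefficient, in a term, of the oriented forest with the tree `Ω_{i,j}` and trivial trees:
it vanishes unless the term has exactly one node `Ω`, and if this node is `Ω a b`, then it is `1`
if `i` is in `a` and `j` is in `b`, it is `-1` if `j` is in `a` and `i` is in `b`, and it is `0`
otherwise. -/
def coeffY (i j : I) : Term I → ℚ
  | leaf _ => 0
  | E a b => coeffY i j a * eps b + eps a * coeffY i j b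
  | Ω a b => eps a * eps b * (cnt i a * cnt j b - cnt j a * cnt i b)

theorem coeffY_rel (i j : I) {r : Term I →₀ ℚ} (h : Rel r) :
    Finsupp.linearCombination ℚ (coeffY i j) r = 0 := by
  induction h with
  | symm a b =>
    simp only [map_sub, Finsupp.linearCombination_single, smul_eq_mul, coeffY]
    have h1 := eps_mul_sgn a b.deg
    have h2 := eps_mul_sgn b a.deg
    rw [mul_comm b.deg] at h2
    linear_combination -coeffY i j b * h1 - coeffY i j a * h2
  | antisymm a b =>
    simp only [map_add, Finsupp.linearCombination_single, smul_eq_mul, coeffY]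
    linear_combination eps b * (cnt i b * cnt j a - cnt j b * cnt i a) * eps_mul_sgn a b.deg
  | assoc a b c =>
    simp only [map_sub, Finsupp.linearCombination_single, smul_eq_mul, coeffY, eps_E]; ring
  | leibniz a b c =>
    simp only [map_sub, Finsupp.linearCombination_single, smul_eq_mul, coeffY, eps_E, eps_Ω, cnt_E]
    linear_combination -eps a * eps c * (cnt i a * cnt j c - cnt j a * cnt i c) *
      eps_mul_sgn b (a.deg + 1)
  | E_left r t h ih =>
    rw [Finsupp.linearCombination_mapDomain]
    exact linearCombination_of_eq (eps t) (coeffY i j t)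
      (fun x _ => by simp only [Function.comp, coeffY]; ring) ih (eps_rel h)
  | E_right t r h ih =>
    rw [Finsupp.linearCombination_mapDomain]
    exact linearCombination_of_eq (eps t) (coeffY i j t)
      (fun x _ => by simp only [Function.comp, coeffY]; ring) ih (eps_rel h)
  | Ω_left r t h _ =>
    obtain ⟨m, d, H⟩ := h.homogeneous
    rw [Finsupp.linearCombination_mapDomain]
    refine linearCombination_of_eq
      (eps t * ((m.count i : ℚ) * cnt j t - (m.count j : ℚ) * cnt i t)) 0
      (fun x hx => ?_) (eps_rel h) (eps_rel h)
    simp only [Function.comp, coeffY, cnt, (H x hx).1]; ring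
  | Ω_right t r h _ =>
    obtain ⟨m, d, H⟩ := h.homogeneous
    rw [Finsupp.linearCombination_mapDomain]
    refine linearCombination_of_eq
      (eps t * (cnt i t * (m.count j : ℚ) - cnt j t * (m.count i : ℚ))) 0
      (fun x hx => ?_) (eps_rel h) (eps_rel h)
    simp only [Function.comp, coeffY, cnt, (H x hx).1]; ring

variable [Fintype I]

/-- The element `Y_{i,j}` of `Bess*(I)`: the element of the dual basis that corresponds to the
forest with exactly one inner vertex, with support `{i, j}` and with the orientation of
`Ω_{i,j}`. -/
def Y (i j : I) : BessDual I :=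
  Bess.lift (fun t => coeffY i j t.1) fun r hr => by
    rw [← coeffY_rel i j hr, Finsupp.linearCombination_mapDomain]; rfl

/-! Forests span `Bess(I)`, and on forests `Y i j` takes the values of a dual basis element. -/

theorem IsTree_eq_leaf {t : Term I} (h : t.IsTree) (hd : t.deg = 0) : ∃ i, t = leaf i := by
  cases t with
  | leaf i => exact ⟨i, rfl⟩
  | E a b => exact h.elim
  | Ω a b => simp [deg] at hd

theorem not_mem_trees {t a b : Term I} (hd : t.deg = 0) : Ω a b ∉ t.trees := by
  induction t with
  | leaf i => simp [trees]
  | E c d ihc ihd =>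
    simp only [deg, Nat.add_eq_zero_iff] at hd
    simp [trees, ihc hd.1, ihd hd.2]
  | Ω c d => simp [deg] at hd

theorem coeffY_of_deg {i j : I} {t : Term I} (hd : t.deg ≠ 1) : coeffY i j t = 0 := by
  induction t with
  | leaf i => rfl
  | E a b iha ihb =>
    simp only [coeffY, eps]
    simp only [deg] at hd
    split_ifs with h1 h2 h2
    · rw [iha (by omega), ihb (by omega)]; simp
    · rw [iha (by omega)]; simp
    · rw [ihb (by omega)]; simp
    · simp
  | Ω a b =>
    simp only [coeffY, eps]
    simp only [deg] at hd
    split_ifs <;> first | omega | simp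

open Classical in
theorem coeffY_forest {i j : I} (hij : i ≠ j) {t : Term I} (ht : t.IsForest) (hd : t.deg = 1) :
    coeffY i j t = if Ω (leaf i) (leaf j) ∈ t.trees then 1 else
      if Ω (leaf j) (leaf i) ∈ t.trees then -1 else 0 := by
  induction t with
  | leaf i => simp [deg] at hd
  | E a b iha ihb =>
    simp only [deg] at hd
    simp only [coeffY, trees, Multiset.mem_add]
    rcases (by omega : a.deg = 1 ∧ b.deg = 0 ∨ a.deg = 0 ∧ b.deg = 1) with ⟨ha, hb⟩ | ⟨ha, hb⟩
    · simp [eps, ha, hb, not_mem_trees hb, iha ht.1 ha]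
    · simp [eps, ha, hb, not_mem_trees ha, ihb ht.2 hb]
  | Ω a b =>
    simp only [deg] at hd
    obtain ⟨k, rfl⟩ := IsTree_eq_leaf ht.1 (by omega)
    obtain ⟨l, rfl⟩ := IsTree_eq_leaf ht.2 (by omega)
    simp only [coeffY, eps, deg, cnt, leaves, trees, Multiset.mem_singleton, Term.Ω.injEq,
      Term.leaf.injEq, Multiset.count_singleton]
    split_ifs <;> grind

open Classical in
/-- The values of `Y i j` at the oriented forests on `I`. -/
theorem Y_forest {i j : I} (hij : i ≠ j) (t : LinTerm I) (ht : t.1.IsForest) :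
    Y i j (mk t) =
      if t.1.deg = 1 ∧ Ω (leaf i) (leaf j) ∈ t.1.trees then 1
      else if t.1.deg = 1 ∧ Ω (leaf j) (leaf i) ∈ t.1.trees then -1
      else 0 := by
  classical
  rw [Y, Bess.lift_mk]
  by_cases hd : t.1.deg = 1
  · rw [coeffY_forest hij ht hd]; simp [hd]
  · rw [coeffY_of_deg hd]; simp [hd]

/-- The span in `Alg I` of the forests with given leaves. -/
def forestSpan (m : Multiset I) : Submodule ℚ (Alg I) :=
  Submodule.span ℚ {x | ∃ t : Term I, t.IsForest ∧ t.leaves = m ∧ cA t = x}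

theorem cA_mem_forestSpan {t : Term I} (h : t.IsForest) : cA t ∈ forestSpan t.leaves :=
  Submodule.subset_span ⟨t, h, rfl, rfl⟩

/-- A linear map given on terms by a context maps spans of forests to spans of forests. -/
theorem map_forestSpan (φ : Alg I →ₗ[ℚ] Alg I) (m n : Multiset I)
    (h : ∀ t : Term I, t.IsForest → t.leaves = m → φ (cA t) ∈ forestSpan n) {x : Alg I}
    (hx : x ∈ forestSpan m) : φ x ∈ forestSpan n := by
  have : forestSpan m ≤ (forestSpan n).comap φ := by
    refine Submodule.span_le.2 ?_
    rintro _ ⟨t, ht, hl, rfl⟩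
    exact h t ht hl
  exact this hx

theorem E_forestSpan {a b : Term I} (ha : cA a ∈ forestSpan a.leaves)
    (hb : cA b ∈ forestSpan b.leaves) : cA (E a b) ∈ forestSpan (a.leaves + b.leaves) := by
  have h1 : ElA b (cA a) = cA (E a b) := by simp [ElA]
  rw [← h1]
  refine map_forestSpan _ _ _ (fun s hs hl => ?_) ha
  have h2 : ElA b (cA s) = ErA s (cA b) := by simp [ElA, ErA]
  rw [h2]
  refine map_forestSpan _ _ _ (fun u hu hl' => ?_) hb
  simp only [ErA, descend_cA]
  rw [← hl, ← hl']
  exact cA_mem_forestSpan (t := E s u) ⟨hs, hu⟩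

theorem Ω_forest {a b : Term I} (ha : a.IsForest) (hb : b.IsForest) :
    cA (Ω a b) ∈ forestSpan (a.leaves + b.leaves) := by
  have tree (a : Term I) (ha : a.IsTree) (b : Term I) (hb : b.IsForest) :
      cA (Ω a b) ∈ forestSpan (a.leaves + b.leaves) := by
    induction b with
    | leaf i => exact cA_mem_forestSpan (t := Ω a (leaf i)) ⟨ha, hb⟩
    | Ω b c => exact cA_mem_forestSpan (t := Ω a (Ω b c)) ⟨ha, hb⟩
    | E b c ihb ihc =>
      rw [cA_leibniz]
      refine Submodule.add_mem _ ?_ (Submodule.smul_mem _ _ ?_)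
      · have := E_forestSpan (a := Ω a b) (b := c) (ihb hb.1) (cA_mem_forestSpan hb.2)
        simpa only [leaves, add_assoc] using this
      · have := E_forestSpan (a := b) (b := Ω a c) (cA_mem_forestSpan hb.1) (ihc hb.2)
        simpa only [leaves, add_left_comm] using this
  induction b with
  | leaf i =>
    rw [cA_antisymm, add_comm]
    exact Submodule.neg_mem _ (Submodule.smul_mem _ _ (tree (leaf i) trivial a ha))
  | Ω b c =>
    rw [cA_antisymm, add_comm]
    exact Submodule.neg_mem _ (Submodule.smul_mem _ _ (tree (Ω b c) hb a ha))
  | E b c ihb ihc =>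
    rw [cA_leibniz]
    refine Submodule.add_mem _ ?_ (Submodule.smul_mem _ _ ?_)
    · have := E_forestSpan (a := Ω a b) (b := c) (ihb hb.1) (cA_mem_forestSpan hb.2)
      simpa only [leaves, add_assoc] using this
    · have := E_forestSpan (a := b) (b := Ω a c) (cA_mem_forestSpan hb.1) (ihc hb.2)
      simpa only [leaves, add_left_comm] using this

theorem mem_forestSpan (t : Term I) : cA t ∈ forestSpan t.leaves := by
  induction t with
  | leaf i => exact cA_mem_forestSpan (t := leaf i) trivial
  | E a b iha ihb => exact E_forestSpan iha ihb
  | Ω a b iha ihb =>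
    have h1 : ΩlA b (cA a) = cA (Ω a b) := by simp [ΩlA]
    rw [← h1]
    refine map_forestSpan _ _ _ (fun s hs hl => ?_) iha
    have h2 : ΩlA b (cA s) = ΩrA s (cA b) := by simp [ΩlA, ΩrA]
    rw [h2]
    refine map_forestSpan _ _ _ (fun u hu hl' => ?_) ihb
    simp only [ΩrA, descend_cA]
    simp only [leaves]
    rw [← hl, ← hl']
    exact Ω_forest hs hu

/-- `Bess(I)` is spanned by oriented forests, so `Y_forest` determines `Y i j`. -/
theorem span_forests :
    Submodule.span ℚ {x | ∃ t : LinTerm I, t.1.IsForest ∧ mk t = x} = ⊤ := by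
  rw [eq_top_iff, ← span_mk, Submodule.span_le]
  rintro _ ⟨t, rfl⟩
  let P : Alg I →ₗ[ℚ] Bess I := descend cls fun r hr => cls_rel hr
  have hP (s : LinTerm I) : P (cA s.1) = mk s := by
    simp only [P, descend_cA, cls, dif_pos s.2]
  have h : forestSpan t.1.leaves ≤
      (Submodule.span ℚ {x | ∃ t : LinTerm I, t.1.IsForest ∧ mk t = x}).comap P := by
    refine Submodule.span_le.2 ?_
    rintro _ ⟨s, hs, hl, rfl⟩
    exact Submodule.subset_span ⟨⟨s, hl.trans t.2⟩, hs, (hP _).symm⟩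
  rw [← hP]
  exact h (mem_forestSpan t.1)

end Y


end

end Bessel

/-! `Bess(I)` is spanned by the classes of multilinear terms, so it suffices to evaluate the triple
product at such a term `t`. Applying the coproduct twice turns `t` into a combination of triples `x
⊗ y ⊗ z`, where each node `Ω` of `t` survives in exactly one of the three terms and becomes `E` in
the other two. The value at `t` is the corresponding combination of the numbers `coeffY i j x *
coeffY j k y * coeffY k i z`. Each of these vanishes separately, so neither signs nor cancellation
play a role.

The vanishing rests on two facts. At a node `E`, a nonzero coefficient of the pair `i, j` forces
both labels to lie on the same side; at a node `Ω`, it forces them to lie on different sides.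
Suppose that all three coefficients are nonzero and look at the root of `t`. If it is `E`, each pair
lies on one side, hence `i`, `j`, `k` all lie on the same side, and one passes to that subterm. If
it is `Ω`, it is `Ω` in one part and `E` in the other two, so two of the three pairs lie on one side
each while the third pair is separated; since any two of the pairs share a label, this is
impossible. This is `Split.coeffY_mul_eq_zero`.

The argument works for arbitrary terms, with `E` allowed below `Ω`, so no reduction to forests is
needed. Both placements of the parentheses produce triples of the same kind (`split_expand_left`,
`split_expand_right`), which takes the place of coassociativity. -/

namespace Bessel

open Term

section Triangle

variable {I : Type*}

/-! ### The twofold coproduct, with its coefficients forgotten -/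

/-- `Split t x y z` says that `x`, `y` and `z` arise from `t` by keeping each node `Ω` of `t` in
exactly one of them and replacing it by `E` in the two others. -/
inductive Split : Term I → Term I → Term I → Term I → Prop
  | leaf (i : I) : Split (leaf i) (leaf i) (leaf i) (leaf i)
  | E {a x y z b x' y' z' : Term I} : Split a x y z → Split b x' y' z' →
      Split (E a b) (E x x') (E y y') (E z z')
  | Ω₁ {a x y z b x' y' z' : Term I} : Split a x y z → Split b x' y' z' →
      Split (Ω a b) (Ω x x') (E y y') (E z z')
  | Ω₂ {a x y z b x' y' z' : Term I} : Split a x y z → Split b x' y' z' →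
      Split (Ω a b) (E x x') (Ω y y') (E z z')
  | Ω₃ {a x y z b x' y' z' : Term I} : Split a x y z → Split b x' y' z' →
      Split (Ω a b) (E x x') (E y y') (Ω z z')

/-- `E` and `Ω` have the same leaves, so exchanging one for the other does not affect labels. Thus
the position of a label in any part can be read off in `t`. -/
theorem Split.leaves_eq {t x y z : Term I} (h : Split t x y z) :
    x.leaves = t.leaves ∧ y.leaves = t.leaves ∧ z.leaves = t.leaves := by
  induction h <;> simp_all [leaves]

theorem mem_expand_E {a b : Term I} {p : ℚ × Term I × Term I} (hp : p ∈ expand (E a b)) :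
    ∃ x ∈ expand a, ∃ y ∈ expand b, p.2.1 = E x.2.1 y.2.1 ∧ p.2.2 = E x.2.2 y.2.2 := by
  simp only [expand, List.mem_flatMap, List.mem_map] at hp
  obtain ⟨x, hx, y, hy, rfl⟩ := hp
  exact ⟨x, hx, y, hy, rfl, rfl⟩

theorem mem_expand_Ω {a b : Term I} {p : ℚ × Term I × Term I} (hp : p ∈ expand (Ω a b)) :
    ∃ x ∈ expand a, ∃ y ∈ expand b, (p.2.1 = Ω x.2.1 y.2.1 ∧ p.2.2 = E x.2.2 y.2.2) ∨
      (p.2.1 = E x.2.1 y.2.1 ∧ p.2.2 = Ω x.2.2 y.2.2) := by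
  simp only [expand, List.mem_append, List.mem_flatMap, List.mem_map] at hp
  rcases hp with ⟨x, hx, y, hy, rfl⟩ | ⟨x, hx, y, hy, rfl⟩
  · exact ⟨x, hx, y, hy, .inl ⟨rfl, rfl⟩⟩
  · exact ⟨x, hx, y, hy, .inr ⟨rfl, rfl⟩⟩

/-- Guarantees that the summands of the coproduct of a multilinear term are again multilinear, so
that `cls` does not take its default value `0` on them. -/
theorem leaves_expand (t : Term I) :
    ∀ p ∈ expand t, p.2.1.leaves = t.leaves ∧ p.2.2.leaves = t.leaves := by
  induction t with
  | leaf i => simp [expand]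
  | E a b iha ihb =>
    intro p hp
    obtain ⟨x, hx, y, hy, h₁, h₂⟩ := mem_expand_E hp
    simp only [h₁, h₂, leaves, iha x hx, ihb y hy, and_self]
  | Ω a b iha ihb =>
    intro p hp
    obtain ⟨x, hx, y, hy, ⟨h₁, h₂⟩ | ⟨h₁, h₂⟩⟩ := mem_expand_Ω hp <;>
      simp only [h₁, h₂, leaves, iha x hx, ihb y hy, and_self]

/-- The outer expansion decides whether a node `Ω` goes to the third part; if it does not, the inner
expansion chooses between the first and the second. -/
theorem split_expand_left (t : Term I) :
    ∀ p ∈ expand t, ∀ q ∈ expand p.2.1, Split t q.2.1 q.2.2 p.2.2 := by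
  induction t with
  | leaf i =>
    simp only [expand, List.mem_singleton]
    rintro _ rfl q hq
    obtain rfl := List.mem_singleton.1 hq
    exact .leaf i
  | E a b iha ihb =>
    intro p hp q hq
    obtain ⟨x, hx, y, hy, h₁, h₂⟩ := mem_expand_E hp
    rw [h₁] at hq
    obtain ⟨u, hu, v, hv, h₃, h₄⟩ := mem_expand_E hq
    rw [h₂, h₃, h₄]
    exact .E (iha x hx u hu) (ihb y hy v hv)
  | Ω a b iha ihb =>
    intro p hp q hq
    obtain ⟨x, hx, y, hy, ⟨h₁, h₂⟩ | ⟨h₁, h₂⟩⟩ := mem_expand_Ω hp <;> rw [h₁] at hq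
    · obtain ⟨u, hu, v, hv, ⟨h₃, h₄⟩ | ⟨h₃, h₄⟩⟩ := mem_expand_Ω hq <;> rw [h₂, h₃, h₄]
      · exact .Ω₁ (iha x hx u hu) (ihb y hy v hv)
      · exact .Ω₂ (iha x hx u hu) (ihb y hy v hv)
    · obtain ⟨u, hu, v, hv, h₃, h₄⟩ := mem_expand_E hq
      rw [h₂, h₃, h₄]
      exact .Ω₃ (iha x hx u hu) (ihb y hy v hv)

/-- The mirror image: the outer expansion singles out the first part, and the inner one separates
the other two. -/
theorem split_expand_right (t : Term I) :
    ∀ p ∈ expand t, ∀ q ∈ expand p.2.2, Split t p.2.1 q.2.1 q.2.2 := by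
  induction t with
  | leaf i =>
    simp only [expand, List.mem_singleton]
    rintro _ rfl q hq
    obtain rfl := List.mem_singleton.1 hq
    exact .leaf i
  | E a b iha ihb =>
    intro p hp q hq
    obtain ⟨x, hx, y, hy, h₁, h₂⟩ := mem_expand_E hp
    rw [h₂] at hq
    obtain ⟨u, hu, v, hv, h₃, h₄⟩ := mem_expand_E hq
    rw [h₁, h₃, h₄]
    exact .E (iha x hx u hu) (ihb y hy v hv)
  | Ω a b iha ihb =>
    intro p hp q hq
    obtain ⟨x, hx, y, hy, ⟨h₁, h₂⟩ | ⟨h₁, h₂⟩⟩ := mem_expand_Ω hp <;> rw [h₂] at hq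
    · obtain ⟨u, hu, v, hv, h₃, h₄⟩ := mem_expand_E hq
      rw [h₁, h₃, h₄]
      exact .Ω₁ (iha x hx u hu) (ihb y hy v hv)
    · obtain ⟨u, hu, v, hv, ⟨h₃, h₄⟩ | ⟨h₃, h₄⟩⟩ := mem_expand_Ω hq <;> rw [h₁, h₃, h₄]
      · exact .Ω₂ (iha x hx u hu) (ihb y hy v hv)
      · exact .Ω₃ (iha x hx u hu) (ihb y hy v hv)

/-! ### Where the labels of a nonzero coefficient lie -/

variable [DecidableEq I]

theorem coeffY_E_ne_zero {i j : I} {a b : Term I} (h : coeffY i j (E a b) ≠ 0) :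
    coeffY i j a ≠ 0 ∨ coeffY i j b ≠ 0 := by
  by_contra! H
  simp [coeffY, H.1, H.2] at h

/-- The coefficient at `Ω` is a multiple of a 2 × 2 determinant of label counts, and one of its two
products must be nonzero. -/
theorem coeffY_Ω_ne_zero {i j : I} {a b : Term I} (h : coeffY i j (Ω a b) ≠ 0) :
    (i ∈ a.leaves ∧ j ∈ b.leaves) ∨ (j ∈ a.leaves ∧ i ∈ b.leaves) := by
  have cnt_zero (i : I) (t : Term I) (h : i ∉ t.leaves) : cnt i t = 0 := by
    simp [cnt, Multiset.count_eq_zero_of_notMem h]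
  by_contra! H
  apply h
  have h₁ : cnt i a * cnt j b = 0 := by
    by_cases hi : i ∈ a.leaves
    · rw [cnt_zero j b (H.1 hi), mul_zero]
    · rw [cnt_zero i a hi, zero_mul]
  have h₂ : cnt j a * cnt i b = 0 := by
    by_cases hj : j ∈ a.leaves
    · rw [cnt_zero i b (H.2 hj), mul_zero]
    · rw [cnt_zero j a hj, zero_mul]
  simp [coeffY, h₁, h₂]

theorem mem_leaves_of_coeffY_ne_zero {i j : I} {t : Term I} (h : coeffY i j t ≠ 0) :
    i ∈ t.leaves ∧ j ∈ t.leaves := by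
  induction t with
  | leaf i => exact (h rfl).elim
  | E a b iha ihb =>
    simp only [leaves, Multiset.mem_add]
    rcases coeffY_E_ne_zero h with h | h
    · exact ⟨.inl (iha h).1, .inl (iha h).2⟩
    · exact ⟨.inr (ihb h).1, .inr (ihb h).2⟩
  | Ω a b =>
    simp only [leaves, Multiset.mem_add]
    rcases coeffY_Ω_ne_zero h with h | h
    · exact ⟨.inl h.1, .inr h.2⟩
    · exact ⟨.inr h.2, .inl h.1⟩

/-- The counterpart of `coeffY_Ω_ne_zero`: a node `E` never separates the two labels. -/
theorem mem_leaves_of_coeffY_E_ne_zero {i j : I} {a b : Term I} (h : coeffY i j (E a b) ≠ 0) :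
    (i ∈ a.leaves ∧ j ∈ a.leaves) ∨ (i ∈ b.leaves ∧ j ∈ b.leaves) :=
  (coeffY_E_ne_zero h).imp mem_leaves_of_coeffY_ne_zero mem_leaves_of_coeffY_ne_zero

/-- The lowest common ancestors of the three pairs out of three leaves of a tree are not distinct,
so they cannot be the only nodes `Ω` of the three parts of a splitting. -/
theorem Split.coeffY_mul_eq_zero {t x y z : Term I} (h : Split t x y z) (ht : t.leaves.Nodup)
    (i j k : I) : coeffY i j x * coeffY j k y * coeffY k i z = 0 := by
  by_contra H
  obtain ⟨⟨hx, hy⟩, hz⟩ : (coeffY i j x ≠ 0 ∧ coeffY j k y ≠ 0) ∧ coeffY k i z ≠ 0 := by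
    simpa only [ne_eq, mul_eq_zero, not_or] using H
  clear H
  induction h with
  | leaf => exact hx rfl
  | E ha hb iha ihb =>
    obtain ⟨na, nb, dis⟩ := Multiset.nodup_add.1 ht
    rw [Multiset.disjoint_left] at dis
    obtain ⟨h₁, h₂, h₃⟩ := ha.leaves_eq
    obtain ⟨h₄, h₅, h₆⟩ := hb.leaves_eq
    have mem (u v : I) (s : Term I) := mem_leaves_of_coeffY_ne_zero (i := u) (j := v) (t := s)
    -- If all three coefficients are nonzero on the same side, the induction hypothesis for that
    -- side applies. Otherwise two of the pairs lie on different sides, and their common label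
    -- contradicts disjointness.
    rcases coeffY_E_ne_zero hx with hx | hx <;> rcases coeffY_E_ne_zero hy with hy | hy <;>
      rcases coeffY_E_ne_zero hz with hz | hz <;> grind
  | Ω₁ ha hb | Ω₂ ha hb | Ω₃ ha hb =>
    obtain ⟨-, -, dis⟩ := Multiset.nodup_add.1 ht
    rw [Multiset.disjoint_left] at dis
    obtain ⟨h₁, h₂, h₃⟩ := ha.leaves_eq
    obtain ⟨h₄, h₅, h₆⟩ := hb.leaves_eq
    -- The three cases differ only in which part keeps `Ω`. In each part the lemma that fits its
    -- root applies: its pair is separated at `Ω` and stays together at `E`. One separated pair and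
    -- two unseparated ones are incompatible with disjoint sides.
    first
      | replace hx := coeffY_Ω_ne_zero hx
      | replace hx := mem_leaves_of_coeffY_E_ne_zero hx
    first
      | replace hy := coeffY_Ω_ne_zero hy
      | replace hy := mem_leaves_of_coeffY_E_ne_zero hy
    first
      | replace hz := coeffY_Ω_ne_zero hz
      | replace hz := mem_leaves_of_coeffY_E_ne_zero hz
    grind

/-! ### From terms to the dual space -/

variable [Fintype I]

theorem Y_cls (i j : I) {t : Term I} (h : t.leaves = Finset.univ.val) :
    Y i j (cls t) = coeffY i j t := by
  rw [cls, dif_pos h, Y, Bess.lift_mk]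

/-- The product is evaluated summand by summand on the expansion of `t`, so it vanishes once every
summand does, whatever the coefficients. -/
theorem mul_cls_eq_zero (f g : BessDual I) {t : Term I}
    (h : ∀ p ∈ expand t, f (cls p.2.1) * g (cls p.2.2) = 0) : (f * g) (cls t) = 0 := by
  by_cases ht : t.leaves = Finset.univ.val
  · rw [cls, dif_pos ht]
    change (LinearMap.mul' ℚ ℚ) (TensorProduct.map f g (coproduct I (mk ⟨t, ht⟩))) = 0
    rw [coproduct_mk]
    change (LinearMap.mul' ℚ ℚ) (TensorProduct.map f g (lsum _ _)) = 0
    rw [map_lsum, map_lsum]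
    refine List.sum_eq_zero fun c hc => ?_
    obtain ⟨p, hp, rfl⟩ := List.mem_map.1 hc
    simp [h p hp]
  · rw [cls, dif_neg ht, map_zero]

theorem dual_eq_zero {f : BessDual I}
    (h : ∀ t : Term I, t.leaves = Finset.univ.val → f (cls t) = 0) : f = 0 := by
  refine LinearMap.ext_on span_mk ?_
  rintro _ ⟨t, rfl⟩
  have := h t.1 t.2
  rwa [cls, dif_pos t.2] at this

end Triangle

end Bessel

theorem mainTheorem9 {I : Type*} [Fintype I] [DecidableEq I] (i j k : I)
    (hij : i ≠ j) (hjk : j ≠ k) (hki : k ≠ i) :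
    (Bessel.Y i j * Bessel.Y j k) * Bessel.Y k i = 0 ∧
      Bessel.Y i j * (Bessel.Y j k * Bessel.Y k i) = 0 := by
  constructor <;> refine Bessel.dual_eq_zero fun t ht => Bessel.mul_cls_eq_zero _ _ fun p hp => ?_
  all_goals
    have hn : t.leaves.Nodup := ht ▸ Finset.univ.nodup
    obtain ⟨h₁, h₂⟩ := Bessel.leaves_expand t p hp
  -- The outer factor may be assumed nonzero. Then the inner product has to vanish at `p.2.1`, which
  -- is checked on its own expansion; the nonzero factor is cancelled from the triple product at the
  -- end.
  · rw [Bessel.Y_cls k i (h₂.trans ht), mul_eq_zero, or_iff_not_imp_right]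
    refine fun hz => Bessel.mul_cls_eq_zero _ _ fun q hq => ?_
    obtain ⟨h₃, h₄⟩ := Bessel.leaves_expand _ q hq
    rw [Bessel.Y_cls i j (h₃.trans (h₁.trans ht)), Bessel.Y_cls j k (h₄.trans (h₁.trans ht))]
    exact (mul_eq_zero.1 ((Bessel.split_expand_left t p hp q hq).coeffY_mul_eq_zero
      hn i j k)).resolve_right hz
  · rw [Bessel.Y_cls i j (h₁.trans ht), mul_eq_zero, or_iff_not_imp_left]
    refine fun hx => Bessel.mul_cls_eq_zero _ _ fun q hq => ?_
    obtain ⟨h₃, h₄⟩ := Bessel.leaves_expand _ q hq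
    rw [Bessel.Y_cls j k (h₃.trans (h₂.trans ht)), Bessel.Y_cls k i (h₄.trans (h₂.trans ht))]
    have := (Bessel.split_expand_right t p hp q hq).coeffY_mul_eq_zero hn i j k
    rw [mul_assoc] at this
    exact (mul_eq_zero.1 this).resolve_left hx
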